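/- Let $M$ be a smooth (Hausdorff, finite-dimensional) manifold with a pseudo-Riemannian metric $\langle\,,\rangle$, i.e. a smooth field of nondegenerate symmetric bilinear forms on the tangent spaces of $M$. Suppose that $(M,\langle\,,\rangle)$ is weakly symmetric: for every $x\in M$ and every nonzero $\xi\in T_xM$ there is an isometry $\phi$ of $(M,\langle\,,\rangle)$ (a diffeomorphism $\phi:M\to M$ with $\langle d\phi(v),d\phi(w)\rangle=\langle v,w\rangle$ for all $y\in M$ and $v,w\in T_yM$) such that $\phi(x)=x$ and $d\phi(\xi)=-\xi$. Then $(M,\langle\,,\rangle)$ is geodesically complete: every maximal geodesic of $M$ (a geodesic $\gamma:J\to M$ of the Levi-Civita connection on a nonempty open interval $J\subseteq\mathbb{R}$ that does not extend to a geodesic on a strictly larger open interval) is defined on all of $\mathbb{R}$. -/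

import Mathlib

open Set
open scoped Manifold ContDiff

noncomputable section

/-- A (smooth) pseudo-Riemannian metric on a smooth manifold `M`: a smooth section `x ↦ ⟨·,·⟩ₓ` of
the bundle of bilinear forms on the tangent spaces, symmetric and nondegenerate on each of them. -/
structure PseudoRiemannianMetric (E : Type*) [NormedAddCommGroup E] [NormedSpace ℝ E]
    (M : Type*) [TopologicalSpace M] [ChartedSpace E M] [IsManifold 𝓘(ℝ, E) ∞ M] where
  /-- The inner product on the tangent spaces. -/
  inner (x : M) : TangentSpace 𝓘(ℝ, E) x →L[ℝ] TangentSpace 𝓘(ℝ, E) x →L[ℝ] ℝ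
  symm (x : M) (v w : TangentSpace 𝓘(ℝ, E) x) : inner x v w = inner x w v
  nondegenerate (x : M) (v : TangentSpace 𝓘(ℝ, E) x) (hv : ∀ w, inner x v w = 0) : v = 0
  contMDiff : ContMDiff 𝓘(ℝ, E) (𝓘(ℝ, E).prod 𝓘(ℝ, E →L[ℝ] E →L[ℝ] ℝ)) ∞
    (fun x ↦ Bundle.TotalSpace.mk' (E →L[ℝ] E →L[ℝ] ℝ) x (inner x))

namespace PseudoRiemannianMetric

variable {E : Type*} [NormedAddCommGroup E] [NormedSpace ℝ E]
  {M : Type*} [TopologicalSpace M] [ChartedSpace E M] [IsManifold 𝓘(ℝ, E) ∞ M]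

/-- An isometry of `(M, g)`: a diffeomorphism `φ` of `M` with `⟨dφ v, dφ w⟩ = ⟨v, w⟩` for all
tangent vectors `v, w` at the same point. -/
def IsIsometry (g : PseudoRiemannianMetric E M) (φ : M ≃ₘ^∞⟮𝓘(ℝ, E), 𝓘(ℝ, E)⟯ M) : Prop :=
  ∀ (x : M) (v w : TangentSpace 𝓘(ℝ, E) x),
    g.inner (φ x) (mfderiv 𝓘(ℝ, E) 𝓘(ℝ, E) φ x v) (mfderiv 𝓘(ℝ, E) 𝓘(ℝ, E) φ x w)
      = g.inner x v w

/-- `(M, g)` is weakly symmetric: for every `x` and every nonzero `ξ ∈ T_x M` there is an isometry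
`φ` with `φ x = x` and `dφ ξ = -ξ`. The two conditions are written together as the equality
`Tφ (x, ξ) = (x, -ξ)` in the tangent bundle. -/
def IsWeaklySymmetric (g : PseudoRiemannianMetric E M) : Prop :=
  ∀ (x : M) (ξ : TangentSpace 𝓘(ℝ, E) x), ξ ≠ 0 →
    ∃ φ : M ≃ₘ^∞⟮𝓘(ℝ, E), 𝓘(ℝ, E)⟯ M, g.IsIsometry φ ∧
      tangentMap 𝓘(ℝ, E) 𝓘(ℝ, E) φ ⟨x, ξ⟩ = ⟨x, -ξ⟩

/-- The coordinate expression of the metric in the chart `κ` at `p`: for `y` in the target of `κ`,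
`(v, w) ↦ ⟨dκ⁻¹ v, dκ⁻¹ w⟩`, the inner product being taken at the point `κ⁻¹ y`.
Its entries in a basis `e` of `E` are the functions `g_{ij} = ⟨∂_i, ∂_j⟩`. -/
def chartMetric (g : PseudoRiemannianMetric E M) (p : M) (y : E) : E →L[ℝ] E →L[ℝ] ℝ :=
  let B : E →L[ℝ] E →L[ℝ] ℝ := g.inner ((extChartAt 𝓘(ℝ, E) p).symm y)
  let L : E →L[ℝ] E := mfderiv 𝓘(ℝ, E) 𝓘(ℝ, E) (extChartAt 𝓘(ℝ, E) p).symm y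
  B.bilinearComp L L

/-- The Christoffel symbols of the first kind of the Levi-Civita connection in the chart at `p`,
as a trilinear expression: `christoffel p y u v w = ⟨∇_u v, w⟩` for constant vector fields
`u, v, w` of the chart, that is `½ (∂_u g(v, w) + ∂_v g(u, w) - ∂_w g(u, v))` at `y`. -/
def christoffel (g : PseudoRiemannianMetric E M) (p : M) (y u v w : E) : ℝ :=
  (1 / 2) * (fderiv ℝ (g.chartMetric p) y u v w + fderiv ℝ (g.chartMetric p) y v u w
    - fderiv ℝ (g.chartMetric p) y w u v)

/-- `γ`, restricted to the nonempty open interval `J` of the real line, is a geodesic of `(M, g)`: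
it is smooth on `J` and satisfies `∇_{γ'} γ' = 0` there. In each chart, with `c` the coordinate
expression of `γ`, the latter is the geodesic equation
`c''ᵏ + ∑ Γᵏᵢⱼ c'ⁱ c'ʲ = 0`, here paired by the (nondegenerate) metric with an arbitrary vector
`w`: `⟨c'', w⟩ + ⟨Γ(c', c'), w⟩ = 0`. Only the values of `γ` on `J` matter. -/
structure IsGeodesicOn (g : PseudoRiemannianMetric E M) (γ : ℝ → M) (J : Set ℝ) : Prop where
  nonempty : J.Nonempty
  isOpen : IsOpen J
  ordConnected : J.OrdConnected
  contMDiffOn : ContMDiffOn 𝓘(ℝ, ℝ) 𝓘(ℝ, E) ∞ γ J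
  geodesic_eq (t : ℝ) (ht : t ∈ J) (p : M) (hp : γ t ∈ (extChartAt 𝓘(ℝ, E) p).source) (w : E) :
    g.chartMetric p (extChartAt 𝓘(ℝ, E) p (γ t))
        (deriv (deriv fun s ↦ extChartAt 𝓘(ℝ, E) p (γ s)) t) w
      + g.christoffel p (extChartAt 𝓘(ℝ, E) p (γ t))
        (deriv (fun s ↦ extChartAt 𝓘(ℝ, E) p (γ s)) t)
        (deriv (fun s ↦ extChartAt 𝓘(ℝ, E) p (γ s)) t) w = 0

/-- The geodesic `γ : J → M` is maximal: it does not extend to a geodesic on a strictly larger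
open interval. -/
def IsMaximalGeodesic (g : PseudoRiemannianMetric E M) (γ : ℝ → M) (J : Set ℝ) : Prop :=
  g.IsGeodesicOn γ J ∧
    ∀ (σ : ℝ → M) (K : Set ℝ), g.IsGeodesicOn σ K → J ⊆ K → EqOn σ γ J → K = J

/-- `(M, g)` is geodesically complete: every maximal geodesic is defined on the entire line. -/
def IsGeodesicallyComplete (g : PseudoRiemannianMetric E M) : Prop :=
  ∀ (γ : ℝ → M) (J : Set ℝ), g.IsMaximalGeodesic γ J → J = univ

end PseudoRiemannianMetric

end

/-! Let `γ` be a maximal geodesic on `J`. If its velocity vanishes at some time, uniqueness makes it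
constant, and maximality gives `J = ℝ`. Otherwise, at each `t₀ ∈ J`, weak symmetry gives an isometry
`φ` that fixes `γ t₀` and reverses the velocity there. Then `t ↦ φ (γ (2 t₀ - t))` is a geodesic
with the position and velocity of `γ` at `t₀`, so maximality puts its domain, the reflection of `J`
in `t₀`, inside `J`. A nonempty open interval stable under reflection in each of its points is the
whole line. Two facts carry this. Isometries preserve geodesics (`geodesicExpr_comp`,
`IsGeodesicOn.comp_isometry`). Geodesics are determined by position and velocity at one time:
locally by uniqueness for ODEs, globally by connectedness, using that `M` is Hausdorff
(`IsGeodesicOn.eqOn_inter`). Gluing turns uniqueness into `IsMaximalGeodesic.subset`. -/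

open scoped Topology

namespace PseudoRiemannianMetric

/-! ### The geodesic equation in a vector space: transformation law and local uniqueness. -/

section Coordinates

variable {E : Type*} [NormedAddCommGroup E] [NormedSpace ℝ E]

/-- The left-hand side `⟨∇_{c'} c', w⟩` of the geodesic equation of a curve `c` in a vector space
with the field of bilinear forms `G`. -/
noncomputable def geodesicExpr (G : E → E →L[ℝ] E →L[ℝ] ℝ) (c : ℝ → E) (t : ℝ) (w : E) : ℝ :=
  G (c t) (deriv (deriv c) t) w + (1 / 2) * (fderiv ℝ G (c t) (deriv c t) (deriv c t) w
    + fderiv ℝ G (c t) (deriv c t) (deriv c t) w - fderiv ℝ G (c t) w (deriv c t) (deriv c t))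

theorem geodesicExpr_congr {G : E → E →L[ℝ] E →L[ℝ] ℝ} {c d : ℝ → E} {t : ℝ} (h : c =ᶠ[𝓝 t] d)
    (w : E) : geodesicExpr G c t w = geodesicExpr G d t w := by
  simp only [geodesicExpr, h.eq_of_nhds, h.deriv_eq, h.deriv.deriv_eq]

theorem geodesicExpr_comp_const_sub (G : E → E →L[ℝ] E →L[ℝ] ℝ) (c : ℝ → E) (a t : ℝ) (w : E) :
    geodesicExpr G (fun s ↦ c (a - s)) t w = geodesicExpr G c (a - t) w := by
  have h : deriv (fun s ↦ c (a - s)) = fun s ↦ -deriv c (a - s) := by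
    funext s
    exact deriv_comp_const_sub (f := c) a s
  have h' : deriv (deriv fun s ↦ c (a - s)) t = deriv (deriv c) (a - t) := by
    rw [h, deriv.fun_neg, deriv_comp_const_sub, neg_neg]
  simp only [geodesicExpr, h', congrFun h t, map_neg, neg_apply, neg_neg]

theorem fderiv_pullback {G₁ G₂ : E → E →L[ℝ] E →L[ℝ] ℝ} {F : E → E} {y : E}
    (hF : ContDiffAt ℝ 2 F y) (hG₁ : DifferentiableAt ℝ G₁ y) (hG₂ : DifferentiableAt ℝ G₂ (F y))
    (h : ∀ᶠ z in 𝓝 y, ∀ v w, G₁ z v w = G₂ (F z) (fderiv ℝ F z v) (fderiv ℝ F z w)) (u v w : E) :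
    fderiv ℝ G₁ y u v w =
      fderiv ℝ G₂ (F y) (fderiv ℝ F y u) (fderiv ℝ F y v) (fderiv ℝ F y w)
      + G₂ (F y) (fderiv ℝ (fderiv ℝ F) y u v) (fderiv ℝ F y w)
      + G₂ (F y) (fderiv ℝ F y v) (fderiv ℝ (fderiv ℝ F) y u w) := by
  have hF1 : HasFDerivAt F (fderiv ℝ F y) y := (hF.differentiableAt (by simp)).hasFDerivAt
  have hF2 : HasFDerivAt (fderiv ℝ F) (fderiv ℝ (fderiv ℝ F) y) y :=
    ((hF.fderiv_right (m := 1) (by norm_num)).differentiableAt (by simp)).hasFDerivAt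
  have hG : HasFDerivAt (fun z ↦ G₂ (F z)) ((fderiv ℝ G₂ (F y)).comp (fderiv ℝ F y)) y :=
    HasFDerivAt.comp (g := G₂) y hG₂.hasFDerivAt hF1
  have h1 := (hG.clm_apply (hF2.clm_apply (hasFDerivAt_const v y))).clm_apply
    (hF2.clm_apply (hasFDerivAt_const w y))
  have h2 := (hG₁.hasFDerivAt.clm_apply (hasFDerivAt_const v y)).clm_apply (hasFDerivAt_const w y)
  have h3 := h2.unique (h1.congr_of_eventuallyEq (h.mono fun z hz ↦ hz v w))
  have h4 := congrArg (fun L : E →L[ℝ] ℝ ↦ L u) h3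
  simp at h4
  linarith

/-- Among the second-derivative terms of `fderiv_pullback`, those pairing `DF c'` with `D²F(c', w)`
cancel in the Christoffel combination, by symmetry of `G₂` and of `D²F`. What remains, `G₂(D²F(c',
c'), DF w)`, is the extra term of `(F ∘ c)''`. -/
theorem geodesicExpr_comp {G₁ G₂ : E → E →L[ℝ] E →L[ℝ] ℝ} {F : E → E} {c : ℝ → E} {t : ℝ}
    (hF : ContDiffAt ℝ 2 F (c t)) (hc : ContDiffAt ℝ 2 c t)
    (hG₁ : DifferentiableAt ℝ G₁ (c t)) (hG₂ : DifferentiableAt ℝ G₂ (F (c t)))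
    (hsymm : ∀ v w, G₂ (F (c t)) v w = G₂ (F (c t)) w v)
    (h : ∀ᶠ z in 𝓝 (c t), ∀ v w, G₁ z v w = G₂ (F z) (fderiv ℝ F z v) (fderiv ℝ F z w)) (w : E) :
    geodesicExpr G₂ (F ∘ c) t (fderiv ℝ F (c t) w) = geodesicExpr G₁ c t w := by
  have hd : deriv (F ∘ c) =ᶠ[𝓝 t] fun s ↦ fderiv ℝ F (c s) (deriv c s) := by
    have h1 := hc.continuousAt.eventually (hF.eventually (by simp))
    filter_upwards [h1, hc.eventually (by simp)] with s hs hs'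
    exact fderiv_comp_deriv s (hs.differentiableAt (by simp)) (hs'.differentiableAt (by simp))
  have hF2 : HasFDerivAt (fderiv ℝ F) (fderiv ℝ (fderiv ℝ F) (c t)) (c t) :=
    ((hF.fderiv_right (m := 1) (by norm_num)).differentiableAt (by simp)).hasFDerivAt
  have hc1 : HasDerivAt c (deriv c t) t := (hc.differentiableAt (by simp)).hasDerivAt
  have hc2 : HasDerivAt (deriv c) (deriv (deriv c) t) t :=
    ((hc.derivWithin (m := 1) (by norm_num)).differentiableAt (by simp)).hasDerivAt
  have hdd : deriv (deriv (F ∘ c)) t = fderiv ℝ (fderiv ℝ F) (c t) (deriv c t) (deriv c t)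
      + fderiv ℝ F (c t) (deriv (deriv c) t) := by
    rw [hd.deriv_eq]
    exact ((hF2.comp_hasDerivAt t hc1).clm_apply hc2).deriv
  have hs : fderiv ℝ (fderiv ℝ F) (c t) w (deriv c t)
      = fderiv ℝ (fderiv ℝ F) (c t) (deriv c t) w :=
    (hF.isSymmSndFDerivAt (by simp)) _ _
  have e1 := fderiv_pullback hF hG₁ hG₂ h (deriv c t) (deriv c t) w
  have e2 := fderiv_pullback hF hG₁ hG₂ h w (deriv c t) (deriv c t)
  have e3 := hsymm (fderiv ℝ F (c t) (deriv c t)) (fderiv ℝ (fderiv ℝ F) (c t) (deriv c t) w)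
  simp only [geodesicExpr, hdd, hd.eq_of_nhds, Function.comp_apply, e1, e2, hs,
    h.self_of_nhds, map_add, add_apply]
  linarith

theorem isInvertible_of_nondegenerate [FiniteDimensional ℝ E] {B : E →L[ℝ] E →L[ℝ] ℝ}
    (hB : ∀ v, (∀ w, B v w = 0) → v = 0) : B.IsInvertible := by
  have hinj : Function.Injective (B : E →ₗ[ℝ] E →L[ℝ] ℝ) :=
    (injective_iff_map_eq_zero _).2 fun v hv ↦ hB v fun w ↦ by
      simpa using congrArg (fun L : E →L[ℝ] ℝ ↦ L w) hv
  have hrank : Module.finrank ℝ E = Module.finrank ℝ (E →L[ℝ] ℝ) := by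
    rw [← (LinearMap.toContinuousLinearMap (𝕜 := ℝ) (E := E) (F' := ℝ)).finrank_eq]
    exact Subspace.dual_finrank_eq.symm
  refine ⟨(LinearEquiv.ofInjectiveOfFinrankEq _ hinj hrank).toContinuousLinearEquiv, ?_⟩
  ext v w
  rfl

/-- The covector `w ↦ ⟨∇_v v, w⟩` for a constant vector field `v`. -/
noncomputable def christoffelCovector (G : E → E →L[ℝ] E →L[ℝ] ℝ) (y v : E) : E →L[ℝ] ℝ :=
  fderiv ℝ G y v v - (1 / 2 : ℝ) • ((fderiv ℝ G y).flip v).flip v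

set_option maxSynthPendingDepth 5 in
theorem contDiffAt_christoffelCovector {G : E → E →L[ℝ] E →L[ℝ] ℝ} {p : E × E}
    (hG : ContDiffAt ℝ 2 G p.1) :
    ContDiffAt ℝ 1 (fun q : E × E ↦ christoffelCovector G q.1 q.2) p := by
  have h : ContDiffAt ℝ 1 (fun q : E × E ↦ fderiv ℝ G q.1) p :=
    (hG.fderiv_right (m := 1) (by norm_num)).comp p contDiffAt_fst
  have h1 : ContDiffAt ℝ 1 (fun q : E × E ↦ (fderiv ℝ G q.1).flip q.2) p :=
    ((ContinuousLinearMap.flipₗᵢ ℝ E E (E →L[ℝ] ℝ)).contDiff.contDiffAt.comp p h).clm_apply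
      contDiffAt_snd
  have h2 : ContDiffAt ℝ 1 (fun q : E × E ↦ ((fderiv ℝ G q.1).flip q.2).flip q.2) p :=
    ((ContinuousLinearMap.flipₗᵢ ℝ E E ℝ).contDiff.contDiffAt.comp p h1).clm_apply contDiffAt_snd
  exact ((h.clm_apply contDiffAt_snd).clm_apply contDiffAt_snd).sub (h2.const_smul _)

/-- The geodesic equation as a first order system on `E × E`. -/
noncomputable def geodesicField (G : E → E →L[ℝ] E →L[ℝ] ℝ) (q : E × E) : E × E :=
  (q.2, -(G q.1).inverse (christoffelCovector G q.1 q.2))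

theorem geodesicExpr_eq (G : E → E →L[ℝ] E →L[ℝ] ℝ) (c : ℝ → E) (t : ℝ) (w : E) :
    geodesicExpr G c t w
      = (G (c t) (deriv (deriv c) t) + christoffelCovector G (c t) (deriv c t)) w := by
  simp [geodesicExpr, christoffelCovector]
  ring

theorem hasDerivAt_geodesicField {G : E → E →L[ℝ] E →L[ℝ] ℝ} {c : ℝ → E} {t : ℝ}
    (hc : ContDiffAt ℝ 2 c t) (hG : (G (c t)).IsInvertible) (h : ∀ w, geodesicExpr G c t w = 0) :
    HasDerivAt (fun s ↦ (c s, deriv c s)) (geodesicField G (c t, deriv c t)) t := by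
  have hc1 : HasDerivAt c (deriv c t) t := (hc.differentiableAt (by simp)).hasDerivAt
  have hc2 : HasDerivAt (deriv c) (deriv (deriv c) t) t :=
    ((hc.derivWithin (m := 1) (by norm_num)).differentiableAt (by simp)).hasDerivAt
  have h0 : G (c t) (deriv (deriv c) t) = -christoffelCovector G (c t) (deriv c t) := by
    rw [eq_neg_iff_add_eq_zero]
    ext w
    rw [← geodesicExpr_eq, h]
    rfl
  have h1 : deriv (deriv c) t = -(G (c t)).inverse (christoffelCovector G (c t) (deriv c t)) := by
    rw [← map_neg, ← h0]
    exact (hG.inverse_apply_eq.2 rfl).symm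
  have := hc1.prodMk hc2
  rwa [h1] at this

/-- A `C²` metric makes `geodesicField` a `C¹` field near the initial data, hence locally Lipschitz,
so ODE uniqueness applies to `(c, c')`. -/
theorem eventuallyEq_of_geodesicExpr_eq_zero [FiniteDimensional ℝ E]
    {G : E → E →L[ℝ] E →L[ℝ] ℝ} {c d : ℝ → E} {t : ℝ}
    (hG : ContDiffAt ℝ 2 G (c t)) (hnondeg : ∀ v, (∀ w, G (c t) v w = 0) → v = 0)
    (hc : ContDiffAt ℝ 2 c t) (hd : ContDiffAt ℝ 2 d t)
    (hc0 : ∀ᶠ s in 𝓝 t, ∀ w, geodesicExpr G c s w = 0)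
    (hd0 : ∀ᶠ s in 𝓝 t, ∀ w, geodesicExpr G d s w = 0)
    (h : c t = d t) (h' : deriv c t = deriv d t) : c =ᶠ[𝓝 t] d := by
  have hinv := isInvertible_of_nondegenerate hnondeg
  have hX : ContDiffAt ℝ 1 (geodesicField G) (c t, deriv c t) := by
    have h1 : ContDiffAt ℝ 1 (fun q : E × E ↦ (G q.1).inverse) (c t, deriv c t) :=
      ContDiffAt.comp (g := ContinuousLinearMap.inverse) _ hinv.contDiffAt_map_inverse
        (ContDiffAt.comp (g := G) _ (hG.of_le (by norm_num)) contDiffAt_fst)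
    exact contDiffAt_snd.prodMk
      ((h1.clm_apply (contDiffAt_christoffelCovector (p := (c t, deriv c t)) hG)).neg)
  obtain ⟨K, s, hs, hK⟩ := hX.exists_lipschitzOnWith
  -- Invertibility is an open condition; it allows the equation, given only paired with test
  -- vectors, to be solved for `c''` at all nearby times.
  have hev : ∀ᶠ z in 𝓝 (c t), (G z).IsInvertible := by
    obtain ⟨e, he⟩ := hinv
    have := hG.continuousAt.eventually (he ▸ e.nhds)
    filter_upwards [this] with z hz
    obtain ⟨f, hf⟩ := hz
    exact ⟨f, hf⟩
  have key : ∀ b : ℝ → E, ContDiffAt ℝ 2 b t → (∀ᶠ s in 𝓝 t, ∀ w, geodesicExpr G b s w = 0) →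
      b t = c t → deriv b t = deriv c t → ∀ᶠ r in 𝓝 t,
        HasDerivAt (fun s ↦ (b s, deriv b s)) (geodesicField G (b r, deriv b r)) r ∧
          (b r, deriv b r) ∈ s := by
    intro b hb hb0 e e'
    have h2 : ContinuousAt (fun r ↦ (b r, deriv b r)) t :=
      hb.continuousAt.prodMk (hb.derivWithin (m := 1) (by norm_num)).continuousAt
    have h3 := h2.eventually (p := (· ∈ s))
      (by simpa only [e, e'] using Filter.eventually_mem_set.2 hs)
    filter_upwards [h3, hb0, hb.eventually (by simp), hb.continuousAt.eventually (e ▸ hev)]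
      with r h4 h5 h6 h7
    exact ⟨hasDerivAt_geodesicField h6 h7 h5, h4⟩
  have := ODE_solution_unique_of_eventually (v := fun _ ↦ geodesicField G) (s := fun _ ↦ s)
    (Filter.Eventually.of_forall fun _ ↦ hK) (key c hc hc0 rfl rfl)
    (key d hd hd0 h.symm h'.symm) (by rw [h, h'])
  exact this.mono fun r hr ↦ congrArg Prod.fst hr

end Coordinates

/-! ### Charts and the coordinate expression of the metric. -/

section Manifold

variable {E : Type*} [NormedAddCommGroup E] [NormedSpace ℝ E]
  {M : Type*} [TopologicalSpace M] [ChartedSpace E M]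

/-- Near `t`, the coordinate expression of `φ ∘ γ` is the image of that of `γ` under the
coordinate expression of `φ`. -/
theorem extChartAt_comp_eventuallyEq {γ : ℝ → M} {t : ℝ} (hγ : ContinuousAt γ t) {p : M}
    (hp : γ t ∈ (extChartAt 𝓘(ℝ, E) p).source) (φ : M → M) (q : M) :
    extChartAt 𝓘(ℝ, E) q ∘ (φ ∘ γ) =ᶠ[𝓝 t]
      (extChartAt 𝓘(ℝ, E) q ∘ φ ∘ (extChartAt 𝓘(ℝ, E) p).symm) ∘ (extChartAt 𝓘(ℝ, E) p ∘ γ) := by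
  filter_upwards [hγ ((isOpen_extChartAt_source (I := 𝓘(ℝ, E)) p).mem_nhds hp)] with s hs
  simp only [Function.comp_apply, (extChartAt 𝓘(ℝ, E) p).left_inv hs]

theorem mfderiv_eq_fderiv_extChartAt {φ : M → M} (hφ : ContMDiff 𝓘(ℝ, E) 𝓘(ℝ, E) ∞ φ) (x : M)
    (ξ : E) {q : M} (hq : φ x = q) : (mfderiv 𝓘(ℝ, E) 𝓘(ℝ, E) φ x ξ : E) =
      fderiv ℝ (extChartAt 𝓘(ℝ, E) q ∘ φ ∘ (extChartAt 𝓘(ℝ, E) x).symm)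
        (extChartAt 𝓘(ℝ, E) x x) ξ := by
  subst hq
  rw [(hφ.contMDiffAt.mdifferentiableAt (by simp)).mfderiv, ModelWithCorners.range_eq_univ,
    fderivWithin_univ]
  rfl

variable [IsManifold 𝓘(ℝ, E) ∞ M]

theorem contMDiffAt_extChartAt_symm {p : M} {y : E} (hy : y ∈ (extChartAt 𝓘(ℝ, E) p).target) :
    ContMDiffAt 𝓘(ℝ, E) 𝓘(ℝ, E) ∞ (extChartAt 𝓘(ℝ, E) p).symm y :=
  (contMDiffOn_extChartAt_symm p).contMDiffAt ((isOpen_extChartAt_target p).mem_nhds hy)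

theorem contMDiffAt_extChartAt_of_mem_source {p x : M}
    (hx : x ∈ (extChartAt 𝓘(ℝ, E) p).source) :
    ContMDiffAt 𝓘(ℝ, E) 𝓘(ℝ, E) ∞ (extChartAt 𝓘(ℝ, E) p) x :=
  contMDiffAt_extChartAt' (by rwa [← extChartAt_source 𝓘(ℝ, E)])

theorem injective_mfderiv_extChartAt_symm {p : M} {y : E}
    (hy : y ∈ (extChartAt 𝓘(ℝ, E) p).target) :
    Function.Injective (mfderiv 𝓘(ℝ, E) 𝓘(ℝ, E) (extChartAt 𝓘(ℝ, E) p).symm y) := by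
  have : IsManifold 𝓘(ℝ, E) 1 M := IsManifold.of_le (n := ∞) (by simp)
  have h := mfderiv_extChartAt_comp_mfderivWithin_extChartAt_symm (I := 𝓘(ℝ, E)) hy
  rw [ModelWithCorners.range_eq_univ, mfderivWithin_univ] at h
  exact Function.LeftInverse.injective fun v ↦ DFunLike.congr_fun h v

theorem surjective_mfderiv_extChartAt_symm {p : M} {y : E}
    (hy : y ∈ (extChartAt 𝓘(ℝ, E) p).target) :
    Function.Surjective (mfderiv 𝓘(ℝ, E) 𝓘(ℝ, E) (extChartAt 𝓘(ℝ, E) p).symm y) := by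
  have : IsManifold 𝓘(ℝ, E) 1 M := IsManifold.of_le (n := ∞) (by simp)
  have h := mfderivWithin_extChartAt_symm_comp_mfderiv_extChartAt (I := 𝓘(ℝ, E)) hy
  rw [ModelWithCorners.range_eq_univ, mfderivWithin_univ] at h
  exact Function.RightInverse.surjective fun v ↦ DFunLike.congr_fun h v

variable (g : PseudoRiemannianMetric E M)

theorem chartMetric_symm (p : M) (y v w : E) : g.chartMetric p y v w = g.chartMetric p y w v :=
  g.symm ((extChartAt 𝓘(ℝ, E) p).symm y) _ _

theorem eq_zero_of_chartMetric_eq_zero {p : M} {y : E}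
    (hy : y ∈ (extChartAt 𝓘(ℝ, E) p).target) (v : E) (hv : ∀ w, g.chartMetric p y v w = 0) :
    v = 0 := by
  refine injective_mfderiv_extChartAt_symm hy (Eq.trans ?_ (map_zero _).symm)
  refine g.nondegenerate _ _ fun w ↦ ?_
  obtain ⟨u, rfl⟩ := surjective_mfderiv_extChartAt_symm hy w
  exact hv u

/-- In finite dimension it suffices to treat the entries for fixed `v` and `w`; each is the smooth
metric paired with two smooth fields along the inverse chart. -/
theorem contDiffOn_chartMetric [FiniteDimensional ℝ E] (p : M) :
    ContDiffOn ℝ ∞ (g.chartMetric p) (extChartAt 𝓘(ℝ, E) p).target := by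
  have : IsManifold 𝓘(ℝ, E) 1 M := IsManifold.of_le (n := ∞) (by simp)
  rw [contDiffOn_clm_apply]
  intro v
  rw [contDiffOn_clm_apply]
  intro w y hy
  refine ContDiffAt.contDiffWithinAt ?_
  have hs : ∀ v : E, ContMDiffAt 𝓘(ℝ, E) 𝓘(ℝ, E).tangent ∞ (fun z : E ↦
      Bundle.TotalSpace.mk' E ((extChartAt 𝓘(ℝ, E) p).symm z)
        (mfderiv 𝓘(ℝ, E) 𝓘(ℝ, E) (extChartAt 𝓘(ℝ, E) p).symm z v)) y := by
    intro v
    have h1 := (contMDiffOn_extChartAt_symm (I := 𝓘(ℝ, E)) (n := ∞) p).contMDiffOn_tangentMapWithin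
      (m := ∞) (by simp) (isOpen_extChartAt_target p).uniqueMDiffOn
    have h2 : ContMDiff 𝓘(ℝ, E) 𝓘(ℝ, E).tangent ∞
        (fun z : E ↦ (⟨z, v⟩ : TangentBundle 𝓘(ℝ, E) E)) := fun z ↦
      contMDiffAt_vectorSpace_iff_contDiffAt.2 contDiffAt_const
    have h3 := h1.comp (h2.contMDiffOn (s := (extChartAt 𝓘(ℝ, E) p).target)) fun z hz ↦ hz
    have hn := (isOpen_extChartAt_target (I := 𝓘(ℝ, E)) p).mem_nhds hy
    refine (h3.contMDiffAt hn).congr_of_eventuallyEq ?_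
    filter_upwards [hn] with z hz
    simp only [Function.comp_apply, tangentMapWithin]
    rw [mfderivWithin_of_isOpen (isOpen_extChartAt_target p) hz]
  have hg := (g.contMDiff ((extChartAt 𝓘(ℝ, E) p).symm y)).comp y (contMDiffAt_extChartAt_symm hy)
  have h : ContMDiffAt 𝓘(ℝ, E) (𝓘(ℝ, E).prod 𝓘(ℝ, ℝ)) ∞ (fun z ↦ Bundle.TotalSpace.mk' ℝ
      (E := Bundle.Trivial M ℝ) ((extChartAt 𝓘(ℝ, E) p).symm z) (g.chartMetric p z v w)) y :=
    ContMDiffAt.clm_bundle_apply₂ (F₁ := E) (F₂ := E) (F₃ := ℝ) hg (hs v) (hs w)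
  simp only [Bundle.contMDiffAt_totalSpace] at h
  exact h.2.contDiffAt

end Manifold

/-! ### Geodesics under isometries, time reversal and gluing. -/

section Geodesics

variable {E : Type*} [NormedAddCommGroup E] [NormedSpace ℝ E]
  {M : Type*} [TopologicalSpace M] [ChartedSpace E M] [IsManifold 𝓘(ℝ, E) ∞ M]
  {g : PseudoRiemannianMetric E M}

theorem contDiffAt_writtenInExtChartAt_of_mem {φ : M → M} (hφ : ContMDiff 𝓘(ℝ, E) 𝓘(ℝ, E) ∞ φ)
    {p q : M} {y : E} (hy : y ∈ (extChartAt 𝓘(ℝ, E) p).target)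
    (hq : φ ((extChartAt 𝓘(ℝ, E) p).symm y) ∈ (extChartAt 𝓘(ℝ, E) q).source) :
    ContDiffAt ℝ ∞ (extChartAt 𝓘(ℝ, E) q ∘ φ ∘ (extChartAt 𝓘(ℝ, E) p).symm) y :=
  ((contMDiffAt_extChartAt_of_mem_source hq).comp y
    (hφ.contMDiffAt.comp y (contMDiffAt_extChartAt_symm hy))).contDiffAt

/-- The chain rule applied to both sides of `κ_q⁻¹ ∘ (κ_q ∘ φ ∘ κ_p⁻¹) = φ ∘ κ_p⁻¹`, valid near `y`.
-/
theorem mfderiv_extChartAt_symm_fderiv {φ : M → M} (hφ : ContMDiff 𝓘(ℝ, E) 𝓘(ℝ, E) ∞ φ)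
    {p q : M} {y : E} (hy : y ∈ (extChartAt 𝓘(ℝ, E) p).target)
    (hq : φ ((extChartAt 𝓘(ℝ, E) p).symm y) ∈ (extChartAt 𝓘(ℝ, E) q).source) (v : E) :
    (mfderiv 𝓘(ℝ, E) 𝓘(ℝ, E) (extChartAt 𝓘(ℝ, E) q).symm
      (extChartAt 𝓘(ℝ, E) q (φ ((extChartAt 𝓘(ℝ, E) p).symm y)))
      (fderiv ℝ (extChartAt 𝓘(ℝ, E) q ∘ φ ∘ (extChartAt 𝓘(ℝ, E) p).symm) y v) : E)
    = (mfderiv 𝓘(ℝ, E) 𝓘(ℝ, E) φ ((extChartAt 𝓘(ℝ, E) p).symm y)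
      (mfderiv 𝓘(ℝ, E) 𝓘(ℝ, E) (extChartAt 𝓘(ℝ, E) p).symm y v) : E) := by
  have hp := contMDiffAt_extChartAt_symm hy
  have hF := contDiffAt_writtenInExtChartAt_of_mem hφ hy hq
  have hc := contMDiffAt_extChartAt_symm ((extChartAt 𝓘(ℝ, E) q).map_source hq)
  have h1 := mfderiv_comp (I := 𝓘(ℝ, E)) (I' := 𝓘(ℝ, E)) (I'' := 𝓘(ℝ, E)) y
    (hc.mdifferentiableAt (by simp)) (hF.contMDiffAt.mdifferentiableAt (by simp))
  have h2 := mfderiv_comp (I := 𝓘(ℝ, E)) (I' := 𝓘(ℝ, E)) (I'' := 𝓘(ℝ, E)) y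
    (hφ.contMDiffAt.mdifferentiableAt (by simp)) (hp.mdifferentiableAt (by simp))
  have hev : (extChartAt 𝓘(ℝ, E) q).symm ∘
      (extChartAt 𝓘(ℝ, E) q ∘ φ ∘ (extChartAt 𝓘(ℝ, E) p).symm)
      =ᶠ[𝓝 y] φ ∘ (extChartAt 𝓘(ℝ, E) p).symm := by
    have hcont : ContinuousAt (φ ∘ (extChartAt 𝓘(ℝ, E) p).symm) y :=
      (hφ.contMDiffAt.comp y hp).continuousAt
    filter_upwards [hcont ((isOpen_extChartAt_source (I := 𝓘(ℝ, E)) q).mem_nhds hq)] with z hz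
    exact (extChartAt 𝓘(ℝ, E) q).left_inv hz
  have h3 := hev.mfderiv_eq (I := 𝓘(ℝ, E)) (I' := 𝓘(ℝ, E))
  rw [mfderiv_eq_fderiv] at h1
  have h4 : ∀ u : E, (mfderiv 𝓘(ℝ, E) 𝓘(ℝ, E) ((extChartAt 𝓘(ℝ, E) q).symm ∘
      (extChartAt 𝓘(ℝ, E) q ∘ φ ∘ (extChartAt 𝓘(ℝ, E) p).symm)) y u : E)
      = (mfderiv 𝓘(ℝ, E) 𝓘(ℝ, E) (φ ∘ (extChartAt 𝓘(ℝ, E) p).symm) y u : E) :=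
    fun u ↦ congrArg (fun L : E →L[ℝ] E ↦ L u) h3
  have h5 := h4 v
  rw [h1, h2] at h5
  exact h5

theorem IsIsometry.chartMetric_pullback {φ : M ≃ₘ^∞⟮𝓘(ℝ, E), 𝓘(ℝ, E)⟯ M} (hφ : g.IsIsometry φ)
    {p q : M} {y : E} (hy : y ∈ (extChartAt 𝓘(ℝ, E) p).target)
    (hq : φ ((extChartAt 𝓘(ℝ, E) p).symm y) ∈ (extChartAt 𝓘(ℝ, E) q).source) (v w : E) :
    g.chartMetric p y v w =
      g.chartMetric q ((extChartAt 𝓘(ℝ, E) q ∘ φ ∘ (extChartAt 𝓘(ℝ, E) p).symm) y)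
        (fderiv ℝ (extChartAt 𝓘(ℝ, E) q ∘ φ ∘ (extChartAt 𝓘(ℝ, E) p).symm) y v)
        (fderiv ℝ (extChartAt 𝓘(ℝ, E) q ∘ φ ∘ (extChartAt 𝓘(ℝ, E) p).symm) y w) := by
  have hd := mfderiv_extChartAt_symm_fderiv φ.contMDiff hy hq
  have hx : (extChartAt 𝓘(ℝ, E) q).symm (extChartAt 𝓘(ℝ, E) q
      (φ ((extChartAt 𝓘(ℝ, E) p).symm y))) = φ ((extChartAt 𝓘(ℝ, E) p).symm y) :=
    (extChartAt 𝓘(ℝ, E) q).left_inv hq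
  -- The type of `g.inner x` depends on `x`, so base point and vectors are generalized and
  -- substituted together.
  have key : ∀ (x : M) (a b : E), x = φ ((extChartAt 𝓘(ℝ, E) p).symm y) →
      a = (mfderiv 𝓘(ℝ, E) 𝓘(ℝ, E) φ ((extChartAt 𝓘(ℝ, E) p).symm y)
        (mfderiv 𝓘(ℝ, E) 𝓘(ℝ, E) (extChartAt 𝓘(ℝ, E) p).symm y v) : E) →
      b = (mfderiv 𝓘(ℝ, E) 𝓘(ℝ, E) φ ((extChartAt 𝓘(ℝ, E) p).symm y)
        (mfderiv 𝓘(ℝ, E) 𝓘(ℝ, E) (extChartAt 𝓘(ℝ, E) p).symm y w) : E) →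
      g.chartMetric p y v w = g.inner x a b := by
    rintro x a b rfl rfl rfl
    exact (hφ ((extChartAt 𝓘(ℝ, E) p).symm y)
      (mfderiv 𝓘(ℝ, E) 𝓘(ℝ, E) (extChartAt 𝓘(ℝ, E) p).symm y v)
      (mfderiv 𝓘(ℝ, E) 𝓘(ℝ, E) (extChartAt 𝓘(ℝ, E) p).symm y w)).symm
  exact key _ _ _ hx (hd v) (hd w)

theorem IsGeodesicOn.geodesicExpr_eq_zero {γ : ℝ → M} {J : Set ℝ} (h : g.IsGeodesicOn γ J) {t : ℝ}
    (ht : t ∈ J) {p : M} (hp : γ t ∈ (extChartAt 𝓘(ℝ, E) p).source) (w : E) :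
    geodesicExpr (g.chartMetric p) (extChartAt 𝓘(ℝ, E) p ∘ γ) t w = 0 :=
  h.geodesic_eq t ht p hp w

theorem IsGeodesicOn.contMDiffAt {γ : ℝ → M} {J : Set ℝ} (h : g.IsGeodesicOn γ J) {t : ℝ}
    (ht : t ∈ J) : ContMDiffAt 𝓘(ℝ, ℝ) 𝓘(ℝ, E) ∞ γ t :=
  h.contMDiffOn.contMDiffAt (h.isOpen.mem_nhds ht)

theorem IsGeodesicOn.contDiffAt {γ : ℝ → M} {J : Set ℝ} (h : g.IsGeodesicOn γ J) {t : ℝ}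
    (ht : t ∈ J) {p : M} (hp : γ t ∈ (extChartAt 𝓘(ℝ, E) p).source) :
    ContDiffAt ℝ ∞ (extChartAt 𝓘(ℝ, E) p ∘ γ) t :=
  ((contMDiffAt_extChartAt_of_mem_source hp).comp t (h.contMDiffAt ht)).contDiffAt

theorem IsGeodesicOn.comp_isometry [FiniteDimensional ℝ E] {γ : ℝ → M} {J : Set ℝ}
    (h : g.IsGeodesicOn γ J) {φ : M ≃ₘ^∞⟮𝓘(ℝ, E), 𝓘(ℝ, E)⟯ M} (hφ : g.IsIsometry φ) :
    g.IsGeodesicOn (φ ∘ γ) J where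
  nonempty := h.nonempty
  isOpen := h.isOpen
  ordConnected := h.ordConnected
  contMDiffOn := φ.contMDiff.comp_contMDiffOn h.contMDiffOn
  geodesic_eq t ht q hq w := by
    have hp : γ t ∈ (extChartAt 𝓘(ℝ, E) (γ t)).source := mem_extChartAt_source (γ t)
    have hy := (extChartAt 𝓘(ℝ, E) (γ t)).map_source hp
    have hsymm : (extChartAt 𝓘(ℝ, E) (γ t)).symm (extChartAt 𝓘(ℝ, E) (γ t) (γ t)) = γ t :=
      (extChartAt 𝓘(ℝ, E) (γ t)).left_inv hp
    have hq' : φ ((extChartAt 𝓘(ℝ, E) (γ t)).symm (extChartAt 𝓘(ℝ, E) (γ t) (γ t))) ∈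
        (extChartAt 𝓘(ℝ, E) q).source := by rwa [hsymm]
    have hF := contDiffAt_writtenInExtChartAt_of_mem φ.contMDiff hy hq'
    have hpull : ∀ᶠ z in 𝓝 (extChartAt 𝓘(ℝ, E) (γ t) (γ t)), ∀ v w,
        g.chartMetric (γ t) z v w = g.chartMetric q
          ((extChartAt 𝓘(ℝ, E) q ∘ φ ∘ (extChartAt 𝓘(ℝ, E) (γ t)).symm) z)
          (fderiv ℝ (extChartAt 𝓘(ℝ, E) q ∘ φ ∘ (extChartAt 𝓘(ℝ, E) (γ t)).symm) z v)
          (fderiv ℝ (extChartAt 𝓘(ℝ, E) q ∘ φ ∘ (extChartAt 𝓘(ℝ, E) (γ t)).symm) z w) := by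
      have hcont : ContinuousAt (φ ∘ (extChartAt 𝓘(ℝ, E) (γ t)).symm)
          (extChartAt 𝓘(ℝ, E) (γ t) (γ t)) :=
        (φ.contMDiff.contMDiffAt.comp _ (contMDiffAt_extChartAt_symm hy)).continuousAt
      filter_upwards [(isOpen_extChartAt_target (I := 𝓘(ℝ, E)) (γ t)).mem_nhds hy,
        hcont ((isOpen_extChartAt_source (I := 𝓘(ℝ, E)) q).mem_nhds hq')] with z hz hz' v w
      exact hφ.chartMetric_pullback hz hz' v w
    have hdiff : ∀ {p : M} {y : E}, y ∈ (extChartAt 𝓘(ℝ, E) p).target →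
        DifferentiableAt ℝ (g.chartMetric p) y := fun {p y} hy ↦
      ((g.contDiffOn_chartMetric p).contDiffAt
        ((isOpen_extChartAt_target p).mem_nhds hy)).differentiableAt (by simp)
    -- The differential pulls the metric back to a nondegenerate form, so it is injective, hence
    -- surjective in finite dimension. Every test vector is then of the form `DF u`, as
    -- `geodesicExpr_comp` requires.
    have hinj : Function.Injective (fderiv ℝ (extChartAt 𝓘(ℝ, E) q ∘ φ ∘
        (extChartAt 𝓘(ℝ, E) (γ t)).symm) (extChartAt 𝓘(ℝ, E) (γ t) (γ t))).toLinearMap :=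
      (injective_iff_map_eq_zero _).2 fun v hv ↦
        g.eq_zero_of_chartMetric_eq_zero hy v fun w ↦ by
          rw [hpull.self_of_nhds, ← ContinuousLinearMap.coe_coe (fderiv ℝ _ _), hv]
          simp
    obtain ⟨u, rfl⟩ := LinearMap.surjective_of_injective hinj w
    have key := geodesicExpr_comp (hF.of_le ENat.LEInfty.out)
      ((h.contDiffAt ht hp).of_le ENat.LEInfty.out)
      (hdiff hy) (hdiff (by
        simp only [Function.comp_apply]
        exact (extChartAt 𝓘(ℝ, E) q).map_source hq'))
      (g.chartMetric_symm q _) hpull u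
    rw [h.geodesicExpr_eq_zero ht hp, ← geodesicExpr_congr
      (extChartAt_comp_eventuallyEq (h.contMDiffAt ht).continuousAt hp φ q)] at key
    exact key

theorem IsGeodesicOn.comp_const_sub {γ : ℝ → M} {J : Set ℝ} (h : g.IsGeodesicOn γ J) (a : ℝ) :
    g.IsGeodesicOn (fun t ↦ γ (a - t)) ((fun t ↦ a - t) ⁻¹' J) where
  nonempty := by
    obtain ⟨t, ht⟩ := h.nonempty
    exact ⟨a - t, by simpa using ht⟩
  isOpen := h.isOpen.preimage (by fun_prop)
  ordConnected := h.ordConnected.preimage_anti fun x y hxy ↦ sub_le_sub_left hxy a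
  contMDiffOn := h.contMDiffOn.comp (t := J)
    (contDiff_const.sub contDiff_id).contMDiff.contMDiffOn subset_rfl
  geodesic_eq t ht p hp w := by
    have := geodesicExpr_comp_const_sub (g.chartMetric p) (extChartAt 𝓘(ℝ, E) p ∘ γ) a t w
    rw [h.geodesicExpr_eq_zero ht hp] at this
    exact this

theorem isGeodesicOn_of_locally {γ : ℝ → M} {J : Set ℝ} (hne : J.Nonempty)
    (hconn : J.OrdConnected)
    (h : ∀ t ∈ J, ∃ σ K, g.IsGeodesicOn σ K ∧ t ∈ K ∧ K ⊆ J ∧ γ =ᶠ[𝓝 t] σ) :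
    g.IsGeodesicOn γ J where
  nonempty := hne
  isOpen := isOpen_iff_mem_nhds.2 fun t ht ↦ by
    obtain ⟨σ, K, hσ, htK, hKJ, -⟩ := h t ht
    exact Filter.mem_of_superset (hσ.isOpen.mem_nhds htK) hKJ
  ordConnected := hconn
  contMDiffOn t ht := by
    obtain ⟨σ, K, hσ, htK, -, he⟩ := h t ht
    exact ((hσ.contMDiffAt htK).congr_of_eventuallyEq he).contMDiffWithinAt
  geodesic_eq t ht p hp w := by
    obtain ⟨σ, K, hσ, htK, -, he⟩ := h t ht
    have := hσ.geodesicExpr_eq_zero htK (he.eq_of_nhds ▸ hp) w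
    rwa [← geodesicExpr_congr (he.fun_comp (extChartAt 𝓘(ℝ, E) p))] at this

theorem isGeodesicOn_const (x : M) : g.IsGeodesicOn (fun _ ↦ x) univ where
  nonempty := univ_nonempty
  isOpen := isOpen_univ
  ordConnected := ordConnected_univ
  contMDiffOn := contMDiffOn_const
  geodesic_eq t _ p _ w := by simp [christoffel]

end Geodesics

/-! ### Global uniqueness, reflection of maximal geodesics, and intervals stable under reflections.
-/

section Completeness

variable {E : Type*} [NormedAddCommGroup E] [NormedSpace ℝ E]
  {M : Type*} [TopologicalSpace M] [ChartedSpace E M] [IsManifold 𝓘(ℝ, E) ∞ M]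
  {g : PseudoRiemannianMetric E M}

theorem IsGeodesicOn.eventuallyEq [FiniteDimensional ℝ E] {γ σ : ℝ → M} {J K : Set ℝ}
    (hγ : g.IsGeodesicOn γ J) (hσ : g.IsGeodesicOn σ K) {t : ℝ} (htJ : t ∈ J) (htK : t ∈ K)
    {p : M} (hp : γ t ∈ (extChartAt 𝓘(ℝ, E) p).source) (h : γ t = σ t)
    (h' : deriv (extChartAt 𝓘(ℝ, E) p ∘ γ) t = deriv (extChartAt 𝓘(ℝ, E) p ∘ σ) t) :
    γ =ᶠ[𝓝 t] σ := by
  have hp' : σ t ∈ (extChartAt 𝓘(ℝ, E) p).source := h ▸ hp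
  have hsource := isOpen_extChartAt_source (I := 𝓘(ℝ, E)) p
  have hγs := (hγ.contMDiffAt htJ).continuousAt (hsource.mem_nhds hp)
  have hσs := (hσ.contMDiffAt htK).continuousAt (hsource.mem_nhds hp')
  have hy := (extChartAt 𝓘(ℝ, E) p).map_source hp
  have key : extChartAt 𝓘(ℝ, E) p ∘ γ =ᶠ[𝓝 t] extChartAt 𝓘(ℝ, E) p ∘ σ := by
    refine eventuallyEq_of_geodesicExpr_eq_zero (G := g.chartMetric p)
      (((g.contDiffOn_chartMetric p).contDiffAt
        ((isOpen_extChartAt_target p).mem_nhds hy)).of_le ENat.LEInfty.out)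
      (g.eq_zero_of_chartMetric_eq_zero hy) ((hγ.contDiffAt htJ hp).of_le ENat.LEInfty.out)
      ((hσ.contDiffAt htK hp').of_le ENat.LEInfty.out) ?_ ?_
      (congrArg (extChartAt 𝓘(ℝ, E) p) h) h'
    · filter_upwards [hγs, hγ.isOpen.mem_nhds htJ] with s hs hsJ
      exact hγ.geodesicExpr_eq_zero hsJ hs
    · filter_upwards [hσs, hσ.isOpen.mem_nhds htK] with s hs hsK
      exact hσ.geodesicExpr_eq_zero hsK hs
  filter_upwards [key, hγs, hσs] with s hs h1 h2
  exact (extChartAt 𝓘(ℝ, E) p).injOn h1 h2 hs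

theorem IsGeodesicOn.continuousAt_deriv {γ : ℝ → M} {J : Set ℝ} (h : g.IsGeodesicOn γ J) {t : ℝ}
    (ht : t ∈ J) {p : M} (hp : γ t ∈ (extChartAt 𝓘(ℝ, E) p).source) :
    ContinuousAt (deriv (extChartAt 𝓘(ℝ, E) p ∘ γ)) t :=
  ((h.contDiffAt ht hp).derivWithin (m := 0) (by simp)).continuousAt

/-- Two geodesics with the same initial point and velocity agree on their common domain. -/
theorem IsGeodesicOn.eqOn_inter [FiniteDimensional ℝ E] [T2Space M] {γ σ : ℝ → M} {J K : Set ℝ}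
    (hγ : g.IsGeodesicOn γ J) (hσ : g.IsGeodesicOn σ K) {t₀ : ℝ} (hJ : t₀ ∈ J) (hK : t₀ ∈ K)
    (h : γ t₀ = σ t₀) (h' : deriv (extChartAt 𝓘(ℝ, E) (γ t₀) ∘ γ) t₀
      = deriv (extChartAt 𝓘(ℝ, E) (γ t₀) ∘ σ) t₀) : EqOn γ σ (J ∩ K) := by
  have hsub : J ∩ K ⊆ {t | γ =ᶠ[𝓝 t] σ} := by
    -- The set of times near which the curves agree is open. It is relatively closed because
    -- position and chart velocity pass to limits, after which local uniqueness applies again.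
    refine (hγ.ordConnected.inter hσ.ordConnected).isPreconnected.subset_of_closure_inter_subset
      isOpen_setOfPred_eventually_nhds
      ⟨t₀, ⟨hJ, hK⟩, hγ.eventuallyEq hσ hJ hK (mem_extChartAt_source _) h h'⟩ ?_
    rintro t ⟨hcl, htJ, htK⟩
    have hfreq : ∃ᶠ s in 𝓝 t, γ =ᶠ[𝓝 s] σ := mem_closure_iff_frequently.1 hcl
    have hpos : γ t = σ t := tendsto_nhds_unique_of_frequently_eq
      (hγ.contMDiffAt htJ).continuousAt (hσ.contMDiffAt htK).continuousAt
      (hfreq.mono fun s hs ↦ hs.eq_of_nhds)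
    have hp : γ t ∈ (extChartAt 𝓘(ℝ, E) (γ t)).source := mem_extChartAt_source _
    refine hγ.eventuallyEq hσ htJ htK hp hpos ?_
    exact tendsto_nhds_unique_of_frequently_eq (hγ.continuousAt_deriv htJ hp)
      (hσ.continuousAt_deriv htK (hpos ▸ hp))
      (hfreq.mono fun s hs ↦ (hs.fun_comp (extChartAt 𝓘(ℝ, E) (γ t))).deriv_eq)
  exact fun t ht ↦ (hsub ht).eq_of_nhds

theorem IsGeodesicOn.exists_union {γ σ : ℝ → M} {J K : Set ℝ} (hγ : g.IsGeodesicOn γ J)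
    (hσ : g.IsGeodesicOn σ K) (hne : (J ∩ K).Nonempty) (h : EqOn γ σ (J ∩ K)) :
    ∃ τ, g.IsGeodesicOn τ (J ∪ K) ∧ EqOn τ γ J := by
  classical
  have hJ : EqOn (J.piecewise γ σ) γ J := piecewise_eqOn J γ σ
  have hK : EqOn (J.piecewise γ σ) σ K := fun t ht ↦ by
    by_cases htJ : t ∈ J
    · rw [hJ htJ, h ⟨htJ, ht⟩]
    · exact piecewise_eq_of_notMem J γ σ htJ
  refine ⟨J.piecewise γ σ, isGeodesicOn_of_locally (hγ.nonempty.mono subset_union_left)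
    (hγ.ordConnected.isPreconnected.union' hne hσ.ordConnected.isPreconnected).ordConnected ?_, hJ⟩
  rintro t (ht | ht)
  · exact ⟨γ, J, hγ, ht, subset_union_left, hJ.eventuallyEq_of_mem (hγ.isOpen.mem_nhds ht)⟩
  · exact ⟨σ, K, hσ, ht, subset_union_right, hK.eventuallyEq_of_mem (hσ.isOpen.mem_nhds ht)⟩

/-- By uniqueness `σ` agrees with `γ` on the overlap, so the two glue to a geodesic on `J ∪ K`,
which maximality forces to equal `J`. -/
theorem IsMaximalGeodesic.subset [FiniteDimensional ℝ E] [T2Space M] {γ σ : ℝ → M} {J K : Set ℝ}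
    (hγ : g.IsMaximalGeodesic γ J) (hσ : g.IsGeodesicOn σ K) {t₀ : ℝ} (hJ : t₀ ∈ J) (hK : t₀ ∈ K)
    (h : γ t₀ = σ t₀) (h' : deriv (extChartAt 𝓘(ℝ, E) (γ t₀) ∘ γ) t₀
      = deriv (extChartAt 𝓘(ℝ, E) (γ t₀) ∘ σ) t₀) : K ⊆ J := by
  obtain ⟨τ, hτ, hτγ⟩ := hγ.1.exists_union hσ ⟨t₀, hJ, hK⟩ (hγ.1.eqOn_inter hσ hJ hK h h')
  exact union_eq_left.1 (hγ.2 τ (J ∪ K) hτ subset_union_left hτγ)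

/-- In a weakly symmetric space, the domain of a maximal geodesic is symmetric about each of its
points at which the velocity does not vanish. -/
theorem IsMaximalGeodesic.preimage_reflection_subset [FiniteDimensional ℝ E] [T2Space M]
    {γ : ℝ → M} {J : Set ℝ} (hγ : g.IsMaximalGeodesic γ J) (hg : g.IsWeaklySymmetric) {t₀ : ℝ}
    (hJ : t₀ ∈ J) (hne : deriv (extChartAt 𝓘(ℝ, E) (γ t₀) ∘ γ) t₀ ≠ 0) :
    (fun t ↦ 2 * t₀ - t) ⁻¹' J ⊆ J := by
  obtain ⟨φ, hφ, hφξ⟩ := hg (γ t₀) (deriv (extChartAt 𝓘(ℝ, E) (γ t₀) ∘ γ) t₀) hne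
  have hx : φ (γ t₀) = γ t₀ := congrArg Bundle.TotalSpace.proj hφξ
  have hξ : fderiv ℝ (extChartAt 𝓘(ℝ, E) (γ t₀) ∘ φ ∘ (extChartAt 𝓘(ℝ, E) (γ t₀)).symm)
      (extChartAt 𝓘(ℝ, E) (γ t₀) (γ t₀)) (deriv (extChartAt 𝓘(ℝ, E) (γ t₀) ∘ γ) t₀)
      = -deriv (extChartAt 𝓘(ℝ, E) (γ t₀) ∘ γ) t₀ :=
    (mfderiv_eq_fderiv_extChartAt φ.contMDiff _ _ hx).symm.trans
      (eq_of_heq (Bundle.TotalSpace.mk.inj hφξ).2)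
  have ht₀ : 2 * t₀ - t₀ = t₀ := by ring
  have hrev := hγ.1.comp_const_sub (2 * t₀)
  have hK : t₀ ∈ (fun t ↦ 2 * t₀ - t) ⁻¹' J := by simpa only [mem_preimage, ht₀] using hJ
  have hp : γ t₀ ∈ (extChartAt 𝓘(ℝ, E) (γ t₀)).source := mem_extChartAt_source _
  have hp' : γ (2 * t₀ - t₀) ∈ (extChartAt 𝓘(ℝ, E) (γ t₀)).source := by rwa [ht₀]
  -- The velocity changes sign twice, once by time reversal and once by `dφ`, so it agrees with that
  -- of `γ` at `t₀`.
  refine hγ.subset (hrev.comp_isometry hφ) hJ hK ?_ ?_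
  · simp only [Function.comp_apply, ht₀, hx]
  · have hy := (extChartAt 𝓘(ℝ, E) (γ t₀)).map_source hp
    have hF := contDiffAt_writtenInExtChartAt_of_mem (q := γ t₀) φ.contMDiff hy
      (by rwa [(extChartAt 𝓘(ℝ, E) (γ t₀)).left_inv hp, hx])
    have hd : deriv (extChartAt 𝓘(ℝ, E) (γ t₀) ∘ fun t ↦ γ (2 * t₀ - t)) t₀
        = -deriv (extChartAt 𝓘(ℝ, E) (γ t₀) ∘ γ) t₀ := by
      have := deriv_comp_const_sub (f := extChartAt 𝓘(ℝ, E) (γ t₀) ∘ γ) (2 * t₀) t₀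
      rwa [ht₀] at this
    rw [(extChartAt_comp_eventuallyEq (hrev.contMDiffAt hK).continuousAt hp' φ (γ t₀)).deriv_eq,
      fderiv_comp_deriv (l := extChartAt 𝓘(ℝ, E) (γ t₀) ∘ φ ∘ (extChartAt 𝓘(ℝ, E) (γ t₀)).symm),
      hd]
    · simp only [Function.comp_apply, ht₀, map_neg, hξ, neg_neg]
    · simp only [Function.comp_apply, ht₀]
      exact hF.differentiableAt (by simp)
    · exact (hrev.contDiffAt hK hp').differentiableAt (by simp)

/-- Reflecting each term of an arithmetic progression in the next one yields the term after that, so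
a progression whose first two terms lie in `J` stays in `J`. Progressions of positive and negative
step from `x` leave every bounded set, and `J` contains everything between them. -/
theorem _root_.Set.OrdConnected.eq_univ_of_reflection {J : Set ℝ} (hconn : J.OrdConnected)
    (ho : IsOpen J) (hne : J.Nonempty) (h : ∀ s ∈ J, ∀ t ∈ J, 2 * t - s ∈ J) : J = univ := by
  obtain ⟨x, hx⟩ := hne
  obtain ⟨ε, hε, hball⟩ := Metric.isOpen_iff.1 ho x hx
  -- The induction carries two consecutive terms, since both are needed to produce the next.
  have key : ∀ δ : ℝ, |δ| < ε → ∀ n : ℕ, x + n * δ ∈ J ∧ x + (n + 1) * δ ∈ J := by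
    intro δ hδ n
    induction n with
    | zero => exact ⟨by simpa using hx, hball (by simpa [Real.dist_eq] using hδ)⟩
    | succ n ih =>
      refine ⟨by simpa using ih.2, ?_⟩
      have := h _ ih.1 _ ih.2
      convert this using 1
      push_cast
      ring
  refine eq_univ_of_forall fun y ↦ ?_
  -- With step `ε / 2`, which is less than `ε` as `key` demands, `n` steps in either direction go
  -- past `y`.
  obtain ⟨n, hn⟩ := exists_nat_gt (|y - x| / (ε / 2))
  rw [div_lt_iff₀ (by positivity)] at hn
  have h1 := (key (-(ε / 2)) (by rw [abs_neg, abs_of_pos] <;> linarith) n).1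
  have h2 := (key (ε / 2) (by rw [abs_of_pos] <;> linarith) n).1
  have h3 := abs_lt.1 hn
  exact hconn.out h1 h2 ⟨by linarith, by linarith⟩

end Completeness

end PseudoRiemannianMetric

/-- Every weakly symmetric pseudo-Riemannian manifold is geodesically complete. -/
theorem proposition4p1 {E : Type*} [NormedAddCommGroup E] [NormedSpace ℝ E] [FiniteDimensional ℝ E]
    {M : Type*} [TopologicalSpace M] [T2Space M] [ChartedSpace E M] [IsManifold 𝓘(ℝ, E) ∞ M]
    (g : PseudoRiemannianMetric E M) (hg : g.IsWeaklySymmetric) :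
    g.IsGeodesicallyComplete := by
  intro γ J hγ
  by_cases h : ∃ t ∈ J, deriv (extChartAt 𝓘(ℝ, E) (γ t) ∘ γ) t = 0
  · obtain ⟨t, ht, h0⟩ := h
    -- Weak symmetry says nothing about the zero vector; here the constant geodesic, defined on all
    -- of `ℝ`, has the same initial data.
    refine univ_subset_iff.1 (hγ.subset (PseudoRiemannianMetric.isGeodesicOn_const (γ t)) ht
      (mem_univ t) rfl ?_)
    rw [h0, Function.comp_def, deriv_const]
  · push Not at h
    refine hγ.1.ordConnected.eq_univ_of_reflection hγ.1.isOpen hγ.1.nonempty fun s hs t ht ↦ ?_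
    exact hγ.preimage_reflection_subset hg ht (h t ht) (by simpa using hs)
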